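/- **Theorem (Improved Sudakov Minoration).** There is a universal constant $C \geq 1$ (independent of all other parameters, in particular of the dimension) such that for every $n \geq 1$, every non-empty compact set $K \subset \mathbb{R}^n$ and every $t > 0$, $$ M\bigl(K,\; C\, t\, M^*(K)\, B_2^n\bigr) \;\leq\; \exp\left( \frac{n}{\max(t,t^2)} \right). $$ Here $B_2^n$ is the closed Euclidean unit ball of $\mathbb{R}^n$; $M(A,B)$ denotes the packing number of $B$ in $A$, i.e. the maximal integer $M$ for which there exist points $x_1,\dots,x_M \in A$ such that the translates $x_i + B$ are mutually disjoint; and $$ M^*(K) := \int_{S^{n-1}} h_K(\theta)\, d\sigma(\theta), \qquad h_K(\theta) := \max_{x \in K} \langle x,\theta\rangle, $$ is half the mean width of $K$, where $\sigma$ is the rotation-invariant probability measure on the Euclidean unit sphere $S^{n-1}$. -/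

import Mathlib

open MeasureTheory
open scoped Pointwise ENNReal

noncomputable section

namespace SudakovMinoration

/-- The packing number `M(A, B)` of `B` in `A`: the largest number `M` of points
`x 0, …, x (M - 1)` of `A` whose translates `x i + B` are mutually disjoint. It is an element of
`ℕ∞`, hence `⊤` if there are arbitrarily large such families; a finite value is attained. -/
def packingNumber {E : Type*} [AddGroup E] (A B : Set E) : ℕ∞ :=
  ⨆ (M : ℕ) (_ : ∃ x : Fin M → E,
    (∀ i, x i ∈ A) ∧ Pairwise fun i j => Disjoint (x i +ᵥ B) (x j +ᵥ B)), (M : ℕ∞)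

/-- The support function `h_K(θ) = max {⟨x, θ⟩ : x ∈ K}`; for a nonempty compact set `K` the
supremum is a maximum. -/
def supportFunction {n : ℕ} (K : Set (EuclideanSpace ℝ (Fin n))) (θ : EuclideanSpace ℝ (Fin n)) :
    ℝ :=
  sSup ((fun x => inner ℝ x θ) '' K)

/-- The rotation-invariant probability measure `σ` on the Euclidean unit sphere of `ℝⁿ`, `n ≥ 1`:
the surface measure divided by its total mass. -/
def sphereProb (n : ℕ) : Measure (Metric.sphere (0 : EuclideanSpace ℝ (Fin n)) 1) :=
  ((volume : Measure (EuclideanSpace ℝ (Fin n))).toSphere Set.univ)⁻¹ •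
    (volume : Measure (EuclideanSpace ℝ (Fin n))).toSphere

/-- Half the mean width, `M*(K) = ∫ h_K dσ` over the unit sphere. (For compact `K` the integrand
is continuous and bounded, hence integrable.) -/
def halfMeanWidth {n : ℕ} (K : Set (EuclideanSpace ℝ (Fin n))) : ℝ :=
  ∫ θ, supportFunction K θ ∂(sphereProb n)

end SudakovMinoration

end

/-
By rotation invariance `∫ h_K dγ = M*(K) ∫ ‖x‖ dγ ≤ √n M*(K)` for the standard Gaussian measure `γ`,
so the width `p = h_K + h_K(-·)` has Gaussian mean `M ≤ 2 √n M*(K)`.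

Dual Sudakov: if the points of `Z`, lying in a ball of radius `R`, are `s`-separated for `p`, then
large multiples of them translate the symmetric set `{p ≤ 4M}` to disjoint sets, and
`γ(v + T) ≥ exp(-‖v‖²/2) γ(T)` for symmetric `T` bounds `|Z|` by `exp(64 (M R / s)²)`.

A `δ`-separated subset of `K` is `δ²`-separated for `p`, because `‖x - y‖² ≤ p(x - y)`. Applied in
balls of radius `2δ`, this bounds the packing number at scale `δ` by that at scale `2δ`, and
iterating gives Sudakov's bound `exp(c n (M*(K)/δ)²)`, which settles `t ≥ 1`. For `t < 1`, use it
only down to the scale `64 M*(K)`; inside balls of that radius a volume comparison gains the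
factor `(1 + 1/(2t))ⁿ ≤ exp(n/(2t))`.
-/

namespace SudakovMinoration

open ProbabilityTheory Module
open scoped NNReal

section PackingNumber

variable {X : Type*} [PseudoEMetricSpace X] {A : Set X} {ε δ : ℝ≥0}

lemma metricPackingNumber_le_one_of_ediam_le (h : Metric.ediam A ≤ ε) :
    Metric.packingNumber ε A ≤ 1 :=
  iSup_le fun C => iSup₂_le fun hCA hC => Set.encard_le_one_iff.2 fun x y hx hy => by
    by_contra hxy
    exact (hC hx hy hxy).not_ge ((Metric.edist_le_ediam_of_mem (hCA hx) (hCA hy)).trans h)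

lemma exists_finset_isSeparated_of_le_metricPackingNumber {N : ℕ}
    (h : N ≤ Metric.packingNumber ε A) :
    ∃ C : Finset X, C.card = N ∧ ↑C ⊆ A ∧ Metric.IsSeparated ε (C : Set X) := by
  obtain ⟨C, hCA, hC, hN⟩ : ∃ C ⊆ A, Metric.IsSeparated ε C ∧ N ≤ C.encard := by
    by_cases htop : Metric.packingNumber ε A = ⊤
    · obtain ⟨C, hC⟩ := lt_iSup_iff.1 (htop ▸ ENat.natCast_lt_top N)
      simp only [lt_iSup_iff] at hC
      obtain ⟨hCA, hC, hN⟩ := hC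
      exact ⟨C, hCA, hC, hN.le⟩
    · obtain ⟨C, hCA, -, hC, hN⟩ := Metric.exists_set_encard_eq_packingNumber htop
      exact ⟨C, hCA, hC, h.trans_eq hN.symm⟩
  obtain ⟨D, hDC, hD⟩ := Set.exists_subset_encard_eq hN
  lift D to Finset X using Set.finite_of_encard_eq_coe hD
  exact ⟨D, by simpa using hD, hDC.trans hCA, hC.subset hDC⟩

lemma metricPackingNumber_le_of_forall_finset {b : ℝ≥0∞}
    (h : ∀ C : Finset X, (C : Set X) ⊆ A → Metric.IsSeparated ε (C : Set X) → C.card ≤ b) :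
    (Metric.packingNumber ε A : ℝ≥0∞) ≤ b := by
  have key (N : ℕ) (hN : N ≤ Metric.packingNumber ε A) : (N : ℝ≥0∞) ≤ b := by
    obtain ⟨C, rfl, hCA, hC⟩ := exists_finset_isSeparated_of_le_metricPackingNumber hN
    exact h C hCA hC
  induction hP : Metric.packingNumber ε A using ENat.recTopCoe with
  | top =>
    exact (ENNReal.eq_top_of_forall_nnreal_le fun r =>
      (ENNReal.coe_le_coe.2 (Nat.le_ceil r)).trans (key _ (by simp [hP]))).ge
  | coe N => simpa using key N hP.ge

lemma metricPackingNumber_le_sum {ι : Type*} (s : Finset ι) (B : ι → Set X)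
    (h : A ⊆ ⋃ i ∈ s, B i) :
    Metric.packingNumber ε A ≤ ∑ i ∈ s, Metric.packingNumber ε (A ∩ B i) :=
  iSup_le fun C => iSup₂_le fun hCA hC => calc
    C.encard ≤ (⋃ i ∈ s, C ∩ B i).encard := by
      refine Set.encard_le_encard ?_
      rw [← Set.inter_iUnion₂]
      exact Set.subset_inter subset_rfl (hCA.trans h)
    _ ≤ ∑ i ∈ s, (C ∩ B i).encard := Finset.set_encard_biUnion_le s _
    _ ≤ ∑ i ∈ s, Metric.packingNumber ε (A ∩ B i) := Finset.sum_le_sum fun i _ =>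
      (hC.subset Set.inter_subset_left).encard_le_packingNumber
        (Set.inter_subset_inter_left _ hCA)

lemma metricPackingNumber_le_mul {b : ℝ≥0∞}
    (h : ∀ x ∈ A, (Metric.packingNumber ε (A ∩ Metric.closedEBall x δ) : ℝ≥0∞) ≤ b) :
    (Metric.packingNumber ε A : ℝ≥0∞) ≤ Metric.packingNumber δ A * b := by
  by_cases htop : Metric.packingNumber δ A = ⊤
  · obtain ⟨x, hx⟩ : A.Nonempty := Metric.packingNumber_pos_iff.1 (htop ▸ ENat.top_pos)
    have hne : (A ∩ Metric.closedEBall x δ).Nonempty := ⟨x, hx, Metric.mem_closedEBall_self⟩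
    have hb : 0 < b := (h x hx).trans_lt' (by simpa [pos_iff_ne_zero] using hne.ne_empty)
    simp [htop, hb.ne']
  obtain ⟨C, hCA, hcover, hcard⟩ :
      ∃ C ⊆ A, Metric.IsCover δ A C ∧ C.encard = Metric.packingNumber δ A :=
    ⟨_, Metric.maximalSeparatedSet_subset, Metric.isCover_maximalSeparatedSet htop,
      Metric.encard_maximalSeparatedSet htop⟩
  lift C to Finset X using Set.encard_ne_top_iff.1 (hcard ▸ htop)
  calc (Metric.packingNumber ε A : ℝ≥0∞)
      ≤ ∑ x ∈ C, (Metric.packingNumber ε (A ∩ Metric.closedEBall x δ) : ℝ≥0∞) := by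
        refine (ENat.toENNReal_le.2 (metricPackingNumber_le_sum C (Metric.closedEBall · δ)
          (Metric.isCover_iff_subset_iUnion_closedEBall.1 hcover))).trans_eq ?_
        exact map_sum ENat.toENNRealRingHom _ _
    _ ≤ ∑ _ ∈ C, b := Finset.sum_le_sum fun _ hx => h _ (hCA hx)
    _ = Metric.packingNumber δ A * b := by simp [← hcard]

end PackingNumber

lemma isSeparated_coe_iff {X : Type*} [PseudoMetricSpace X] {ε : ℝ≥0} {C : Set X} :
    Metric.IsSeparated ε C ↔ C.Pairwise fun x y => (ε : ℝ) < dist x y := by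
  simp only [Metric.IsSeparated, edist_nndist, ENNReal.coe_lt_coe, ← NNReal.coe_lt_coe, coe_nndist]

lemma subsingleton_of_forall_metricPackingNumber_le_one {X : Type*} [MetricSpace X] {A : Set X}
    (h : ∀ ε : ℝ≥0, 0 < ε → Metric.packingNumber ε A ≤ 1) : A.Subsingleton := by
  by_contra hA
  obtain ⟨x, hx, y, hy, hxy⟩ := Set.not_subsingleton_iff.1 hA
  have hdist : 0 < nndist x y := pos_iff_ne_zero.2 (nndist_eq_zero.not.2 hxy)
  have hsep : Metric.IsSeparated (nndist x y / 2 : ℝ≥0) ({x, y} : Set X) := by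
    have hlt : nndist x y / 2 < nndist x y := NNReal.half_lt_self hdist.ne'
    refine isSeparated_coe_iff.2 (Set.pairwise_pair.2 fun _ => ⟨?_, ?_⟩)
    · exact_mod_cast hlt
    · rw [dist_comm]
      exact_mod_cast hlt
  have hcard := (hsep.encard_le_packingNumber (Set.pair_subset hx hy)).trans (h _ (half_pos hdist))
  rw [Set.encard_pair hxy] at hcard
  exact absurd hcard (by decide)

section NormedSpace

variable {E : Type*} [NormedAddCommGroup E] [NormedSpace ℝ E]

lemma packingNumber_closedBall_le (A : Set E) (r : ℝ≥0) :
    packingNumber A (Metric.closedBall 0 r) ≤ Metric.packingNumber (2 * r) A := by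
  refine iSup₂_le fun M ⟨x, hxA, hdisj⟩ => ?_
  replace hdisj : Pairwise fun i j =>
      Disjoint (Metric.closedBall (x i) r) (Metric.closedBall (x j) r) := by
    simpa only [Metric.vadd_closedBall, vadd_eq_add, add_zero] using hdisj
  have hsep {i j : Fin M} (hij : i ≠ j) : 2 * (r : ℝ) < dist (x i) (x j) := by
    have h : (r : ℝ) + r < dist (x i) (x j) :=
      (disjoint_closedBall_closedBall_iff r.2 r.2).1 (hdisj hij)
    linarith
  have hinj : Function.Injective x := fun i j hij => by
    by_contra hne
    exact (hsep hne).not_ge (by simp [hij])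
  calc (M : ℕ∞) = (Set.range x).encard := by
        rw [← Set.image_univ, hinj.encard_image, Set.encard_univ, ENat.card_eq_coe_fintype_card,
          Fintype.card_fin]
    _ ≤ Metric.packingNumber (2 * r) A := by
        refine Metric.IsSeparated.encard_le_packingNumber (Set.range_subset_iff.2 hxA)
          (isSeparated_coe_iff.2 ?_)
        rintro _ ⟨i, rfl⟩ _ ⟨j, rfl⟩ hij
        exact hsep (ne_of_apply_ne x hij)

lemma metricPackingNumber_le_of_subset_closedBall [FiniteDimensional ℝ E] {A : Set E} {y : E}
    {R r : ℝ≥0} (hr : 0 < r) (hA : A ⊆ Metric.closedBall y R) :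
    (Metric.packingNumber (2 * r) A : ℝ≥0∞) ≤ ENNReal.ofReal ((1 + R / r) ^ finrank ℝ E) := by
  borelize E
  let μ : Measure E := Measure.addHaar
  have hr' : (0 : ℝ) < r := hr
  refine metricPackingNumber_le_of_forall_finset fun C hCA hC => ?_
  have hdisj : (C : Set E).PairwiseDisjoint fun x => Metric.ball x r := fun x hx z hz hxz =>
    Metric.ball_disjoint_ball <| by
      have := isSeparated_coe_iff.1 hC hx hz hxz
      push_cast at this
      linarith
  have hsub : (⋃ x ∈ C, Metric.ball x r) ⊆ Metric.ball y (R + r) :=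
    Set.iUnion₂_subset fun x hx => Metric.ball_subset_ball' <| by
      linarith [Metric.mem_closedBall.1 (hA (hCA hx))]
  have hvol : C.card * μ (Metric.ball 0 r) ≤
      ENNReal.ofReal ((1 + R / r) ^ finrank ℝ E) * μ (Metric.ball 0 r) := calc
    C.card * μ (Metric.ball 0 r) = ∑ x ∈ C, μ (Metric.ball x r) := by
        simp only [Measure.addHaar_ball_center, Finset.sum_const, nsmul_eq_mul]
    _ = μ (⋃ x ∈ C, Metric.ball x r) :=
        (measure_biUnion_finset hdisj fun x _ => measurableSet_ball).symm
    _ ≤ μ (Metric.ball y (R + r)) := measure_mono hsub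
    _ = ENNReal.ofReal ((1 + R / r) ^ finrank ℝ E) * μ (Metric.ball 0 r) := by
        rw [← Measure.addHaar_ball_mul_of_pos μ y (by positivity)]
        congr 2
        field_simp
        ring
  exact (ENNReal.mul_le_mul_iff_left (Metric.measure_ball_pos μ 0 hr').ne'
    measure_ball_lt_top.ne).1 hvol

lemma metricPackingNumber_le_exp_of_subset_closedBall [FiniteDimensional ℝ E] {A : Set E} {y : E}
    {R r : ℝ≥0} (hr : 0 < r) (hA : A ⊆ Metric.closedBall y R) :
    (Metric.packingNumber (2 * r) A : ℝ≥0∞) ≤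
      ENNReal.ofReal (Real.exp (finrank ℝ E * (R / r))) := by
  refine (metricPackingNumber_le_of_subset_closedBall hr hA).trans (ENNReal.ofReal_le_ofReal ?_)
  rw [Real.exp_nat_mul]
  gcongr
  rw [add_comm]
  exact Real.add_one_le_exp _

end NormedSpace

-- The factor `4 / 3 = ∑ 4⁻ᵏ` comes from iterating `h_mul` over the scales `2 ^ k * δ`.
lemma le_exp_of_le_mul_exp_two_mul {f : ℝ≥0 → ℝ≥0∞} {a : ℝ} {D : ℝ≥0} (ha : 0 ≤ a)
    (h_one : ∀ δ, D ≤ δ → f δ ≤ 1)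
    (h_mul : ∀ δ, 0 < δ → f δ ≤ f (2 * δ) * ENNReal.ofReal (Real.exp (a / δ ^ 2)))
    {δ : ℝ≥0} (hδ : 0 < δ) : f δ ≤ ENNReal.ofReal (Real.exp (4 / 3 * (a / δ ^ 2))) := by
  suffices H : ∀ (k : ℕ) (δ : ℝ≥0), 0 < δ → D ≤ 2 ^ k * δ →
      f δ ≤ ENNReal.ofReal (Real.exp (4 / 3 * (a / δ ^ 2))) by
    obtain ⟨k, hk⟩ := pow_unbounded_of_one_lt (D / δ) one_lt_two
    exact H k δ hδ ((div_le_iff₀ hδ).1 hk.le)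
  intro k
  induction k with
  | zero =>
    intro δ hδ hD
    exact (h_one δ (by simpa using hD)).trans
      (ENNReal.one_le_ofReal.2 (Real.one_le_exp (by positivity)))
  | succ k ih =>
    intro δ hδ hD
    calc f δ ≤ f (2 * δ) * ENNReal.ofReal (Real.exp (a / δ ^ 2)) := h_mul δ hδ
      _ ≤ ENNReal.ofReal (Real.exp (4 / 3 * (a / (2 * δ : ℝ≥0) ^ 2))) *
            ENNReal.ofReal (Real.exp (a / δ ^ 2)) := by
          gcongr
          exact ih _ (by positivity) (hD.trans_eq (by ring))
      _ = ENNReal.ofReal (Real.exp (4 / 3 * (a / δ ^ 2))) := by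
          rw [← ENNReal.ofReal_mul (Real.exp_pos _).le, ← Real.exp_add]
          congr 2
          push_cast
          field_simp
          ring

section Gaussian

variable (E : Type*) [NormedAddCommGroup E] [InnerProductSpace ℝ E]

/-- The density of the standard Gaussian measure on `E` with respect to Lebesgue measure. -/
noncomputable def stdGaussianPDFReal (x : E) : ℝ :=
  ((2 * Real.pi) ^ (finrank ℝ E / 2 : ℝ))⁻¹ * Real.exp (-‖x‖ ^ 2 / 2)

variable {E}

lemma stdGaussianPDFReal_pos (x : E) : 0 < stdGaussianPDFReal E x := by
  unfold stdGaussianPDFReal; positivity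

lemma continuous_stdGaussianPDFReal : Continuous (stdGaussianPDFReal E) := by
  unfold stdGaussianPDFReal; fun_prop

lemma two_mul_exp_mul_stdGaussianPDFReal_le (v x : E) :
    2 * (Real.exp (-‖v‖ ^ 2 / 2) * stdGaussianPDFReal E x) ≤
      stdGaussianPDFReal E (v + x) + stdGaussianPDFReal E (-v + x) := by
  set a := Real.exp (-‖v‖ ^ 2 / 2) * stdGaussianPDFReal E x with ha
  have ha_pos : 0 < a := mul_pos (Real.exp_pos _) (stdGaussianPDFReal_pos x)
  have hshift (w : E) (hw : ‖w‖ = ‖v‖) :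
      stdGaussianPDFReal E (w + x) = a * Real.exp (-inner ℝ w x) := by
    rw [ha, stdGaussianPDFReal, stdGaussianPDFReal, mul_left_comm, mul_assoc, ← Real.exp_add,
      ← Real.exp_add, norm_add_sq_real, hw]
    ring_nf
  calc 2 * a ≤ 2 * a * Real.cosh (inner ℝ v x) :=
        le_mul_of_one_le_right (by positivity) (Real.one_le_cosh _)
    _ = stdGaussianPDFReal E (v + x) + stdGaussianPDFReal E (-v + x) := by
        rw [hshift v rfl, hshift (-v) (norm_neg v), inner_neg_left, neg_neg, Real.cosh_eq]
        ring

variable [FiniteDimensional ℝ E] [MeasurableSpace E] [BorelSpace E]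

lemma integrable_stdGaussianPDFReal : Integrable (stdGaussianPDFReal E) := by
  have h : Integrable fun x : E => Real.exp (-(1 / 2) * ‖x‖ ^ 2) := by
    refine .of_integral_ne_zero ?_
    rw [GaussianFourier.integral_rexp_neg_mul_sq_norm (by norm_num)]
    positivity
  refine (h.const_mul ((2 * Real.pi) ^ (finrank ℝ E / 2 : ℝ))⁻¹).congr (.of_forall fun x => ?_)
  simp only [stdGaussianPDFReal]
  ring_nf

lemma charFun_withDensity_stdGaussianPDFReal (t : E) :
    charFun (volume.withDensity fun x => ENNReal.ofReal (stdGaussianPDFReal E x)) t =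
      Complex.exp (-‖t‖ ^ 2 / 2) := by
  set c : ℂ := (((2 * Real.pi) ^ (finrank ℝ E / 2 : ℝ) : ℝ) : ℂ) with hc_def
  have hc : c ≠ 0 := Complex.ofReal_ne_zero.2 (by positivity)
  have hint (x : E) : (ENNReal.ofReal (stdGaussianPDFReal E x)).toReal •
      Complex.exp (inner ℝ x t * Complex.I) =
        c⁻¹ * Complex.exp (-(1 / 2) * ‖x‖ ^ 2 + Complex.I * inner ℝ t x) := by
    rw [ENNReal.toReal_ofReal (stdGaussianPDFReal_pos x).le, stdGaussianPDFReal, real_inner_comm,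
      Complex.real_smul, Complex.ofReal_mul, Complex.ofReal_inv, ← hc_def, Complex.ofReal_exp,
      mul_assoc, ← Complex.exp_add]
    push_cast
    ring_nf
  have hpow : (Real.pi / (1 / 2) : ℂ) ^ (finrank ℝ E / 2 : ℂ) = c := by
    rw [hc_def, Complex.ofReal_cpow (by positivity)]
    push_cast
    ring_nf
  rw [charFun_apply, integral_withDensity_eq_integral_toReal_smul
    continuous_stdGaussianPDFReal.measurable.ennreal_ofReal (by simp),
    integral_congr_ae (.of_forall hint), integral_const_mul,
    GaussianFourier.integral_cexp_neg_mul_sq_norm_add (by norm_num), hpow,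
    inv_mul_cancel_left₀ hc, Complex.I_sq]
  ring_nf

variable (E) in
lemma stdGaussian_eq_withDensity :
    stdGaussian E = volume.withDensity fun x => ENNReal.ofReal (stdGaussianPDFReal E x) := by
  have := isFiniteMeasure_withDensity_ofReal (integrable_stdGaussianPDFReal (E := E)).2
  refine Measure.ext_of_charFun (funext fun t => ?_)
  rw [charFun_stdGaussian, charFun_withDensity_stdGaussianPDFReal]

instance : (stdGaussian E).IsNegInvariant :=
  ⟨stdGaussian_map (LinearIsometryEquiv.neg ℝ)⟩

lemma stdGaussian_vadd (T : Set E) (v : E) :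
    stdGaussian E (v +ᵥ T) = ∫⁻ x in T, ENNReal.ofReal (stdGaussianPDFReal E (v + x)) := by
  rw [stdGaussian_eq_withDensity, withDensity_apply']
  have h := (measurePreserving_add_left volume v).setLIntegral_comp_emb
    (MeasurableEquiv.addLeft v).measurableEmbedding
    (fun x => ENNReal.ofReal (stdGaussianPDFReal E x)) T
  exact h.symm

-- Averaging over the shifts by `v` and `-v` cancels the linear term of the shifted density.
lemma exp_mul_stdGaussian_le_stdGaussian_vadd {T : Set E} (hneg : -T = T) (v : E) :
    ENNReal.ofReal (Real.exp (-‖v‖ ^ 2 / 2)) * stdGaussian E T ≤ stdGaussian E (v +ᵥ T) := by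
  have hsymm : stdGaussian E (-v +ᵥ T) = stdGaussian E (v +ᵥ T) := by
    rw [← Measure.measure_neg (stdGaussian E) (v +ᵥ T)]
    congr 1
    rw [← hneg]
    ext x
    simp [Set.mem_vadd_set_iff_neg_vadd_mem, hneg, add_comm]
  refine (ENNReal.mul_le_mul_iff_right two_ne_zero ENNReal.ofNat_ne_top).1 ?_
  calc 2 * (ENNReal.ofReal (Real.exp (-‖v‖ ^ 2 / 2)) * stdGaussian E T)
      = ∫⁻ x in T, ENNReal.ofReal (2 * (Real.exp (-‖v‖ ^ 2 / 2) * stdGaussianPDFReal E x)) := by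
        have hmeas := continuous_stdGaussianPDFReal (E := E).measurable.ennreal_ofReal
        simp_rw [ENNReal.ofReal_mul zero_le_two, ENNReal.ofReal_mul (Real.exp_pos _).le]
        rw [lintegral_const_mul _ (by fun_prop), lintegral_const_mul _ hmeas,
          stdGaussian_eq_withDensity, withDensity_apply', ENNReal.ofReal_ofNat]
    _ ≤ ∫⁻ x in T, (ENNReal.ofReal (stdGaussianPDFReal E (v + x)) +
          ENNReal.ofReal (stdGaussianPDFReal E (-v + x))) := by
        refine lintegral_mono fun x => ?_
        rw [← ENNReal.ofReal_add (stdGaussianPDFReal_pos _).le (stdGaussianPDFReal_pos _).le]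
        exact ENNReal.ofReal_le_ofReal (two_mul_exp_mul_stdGaussianPDFReal_le v x)
    _ = stdGaussian E (v +ᵥ T) + stdGaussian E (-v +ᵥ T) := by
        have hmeas := continuous_stdGaussianPDFReal (E := E).measurable
        rw [stdGaussian_vadd, stdGaussian_vadd, lintegral_add_left (by fun_prop)]
    _ = 2 * stdGaussian E (v +ᵥ T) := by rw [hsymm, two_mul]

lemma card_mul_stdGaussian_le_exp {T : Set E} (hT : MeasurableSet T) (hneg : -T = T) {ι : Type*}
    {Z : Finset ι} {v : ι → E} {R : ℝ} (hv : ∀ i ∈ Z, ‖v i‖ ≤ R)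
    (hdisj : (Z : Set ι).PairwiseDisjoint fun i => v i +ᵥ T) :
    Z.card * stdGaussian E T ≤ ENNReal.ofReal (Real.exp (R ^ 2 / 2)) := by
  have hlower (i) (hi : i ∈ Z) :
      ENNReal.ofReal (Real.exp (-(R ^ 2 / 2))) * stdGaussian E T ≤ stdGaussian E (v i +ᵥ T) := by
    refine le_trans ?_ (exp_mul_stdGaussian_le_stdGaussian_vadd hneg (v i))
    rw [← neg_div]
    gcongr
    exact hv i hi
  have hsum : Z.card * (ENNReal.ofReal (Real.exp (-(R ^ 2 / 2))) * stdGaussian E T) ≤ 1 := calc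
    _ ≤ ∑ i ∈ Z, stdGaussian E (v i +ᵥ T) := by
      rw [← nsmul_eq_mul]
      exact Finset.card_nsmul_le_sum _ _ _ hlower
    _ = stdGaussian E (⋃ i ∈ Z, v i +ᵥ T) :=
      (measure_biUnion_finset hdisj fun i _ => hT.const_vadd _).symm
    _ ≤ 1 := prob_le_one
  have hpos : 0 < Real.exp (R ^ 2 / 2) := Real.exp_pos _
  rwa [mul_left_comm, Real.exp_neg, ENNReal.ofReal_inv_of_pos hpos,
    ENNReal.inv_mul_le_iff (by simpa using hpos) ENNReal.ofReal_ne_top, mul_one] at hsum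

lemma integrable_stdGaussian_of_abs_le_mul_norm {f : E → ℝ} (hf : Continuous f) {c : ℝ}
    (h : ∀ x, |f x| ≤ c * ‖x‖) : Integrable f (stdGaussian E) :=
  ((IsGaussian.integrable_id (μ := stdGaussian E)).norm.const_mul c).mono'
    hf.aestronglyMeasurable (.of_forall h)

lemma integral_inner_sq_stdGaussian (u : E) : ∫ x, inner ℝ u x ^ 2 ∂stdGaussian E = ‖u‖ ^ 2 := by
  have h := variance_dual_stdGaussian (innerSL ℝ u)
  rw [variance_of_integral_eq_zero (by fun_prop) (integral_strongDual_stdGaussian _),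
    innerSL_apply_norm] at h
  exact h

lemma integral_norm_sq_stdGaussian : ∫ x, ‖x‖ ^ 2 ∂stdGaussian E = finrank ℝ E := by
  let b := stdOrthonormalBasis ℝ E
  have hint (i) : Integrable (fun x => inner ℝ (b i) x ^ 2) (stdGaussian E) :=
    (IsGaussian.memLp_dual (stdGaussian E) (innerSL ℝ (b i)) 2 (by simp)).integrable_sq
  simp_rw [← b.sum_sq_inner_right]
  rw [integral_finsetSum _ fun i _ => hint i]
  simp_rw [integral_inner_sq_stdGaussian, b.norm_eq_one]
  simp

lemma integral_norm_stdGaussian_sq_le : (∫ x, ‖x‖ ∂stdGaussian E) ^ 2 ≤ finrank ℝ E := by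
  rw [← integral_norm_sq_stdGaussian, ← sub_nonneg]
  exact (variance_nonneg _ _).trans_eq
    (variance_eq_sub (IsGaussian.memLp_two_id (μ := stdGaussian E)).norm)

lemma integral_norm_stdGaussian_pos [Nontrivial E] : 0 < ∫ x, ‖x‖ ∂stdGaussian E := by
  refine (integral_nonneg norm_nonneg).lt_of_ne' fun h => ?_
  have hae : (fun x : E => ‖x‖) =ᵐ[stdGaussian E] 0 :=
    (integral_eq_zero_iff_of_nonneg norm_nonneg IsGaussian.integrable_id.norm).1 h
  have hsq : ∫ x, ‖x‖ ^ 2 ∂stdGaussian E = 0 :=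
    (integral_congr_ae (hae.fun_comp (· ^ 2))).trans (by simp)
  rw [integral_norm_sq_stdGaussian, Nat.cast_eq_zero] at hsq
  exact finrank_pos.ne' hsq

end Gaussian

lemma disjoint_vadd_seminormClosedBall {E : Type*} [AddCommGroup E] [Module ℝ E] (p : Seminorm ℝ E)
    {r s : ℝ} (hr : 0 < r) (hs : 0 < s) {z w : E} (h : s < p (z - w)) (y : E) :
    Disjoint ((2 * r / s) • (z - y) +ᵥ p.closedBall 0 r)
      ((2 * r / s) • (w - y) +ᵥ p.closedBall 0 r) := by
  simp only [Seminorm.vadd_closedBall, vadd_eq_add, add_zero]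
  refine Set.disjoint_left.2 fun u hz hw => ?_
  rw [Seminorm.mem_closedBall] at hz hw
  have hlt : 2 * r < p ((2 * r / s) • (z - w)) := calc
    2 * r = 2 * r / s * s := by field_simp
    _ < 2 * r / s * p (z - w) := by gcongr
    _ = p ((2 * r / s) • (z - w)) := by
      rw [map_smul_eq_mul, Real.norm_of_nonneg (by positivity)]
  have hle := map_sub_le_add p (u - (2 * r / s) • (w - y)) (u - (2 * r / s) • (z - y))
  rw [sub_sub_sub_cancel_left, ← smul_sub, sub_sub_sub_cancel_right] at hle
  linarith

section FiniteDimensional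

variable {E : Type*} [NormedAddCommGroup E] [NormedSpace ℝ E] [FiniteDimensional ℝ E]
  (p : Seminorm ℝ E)

lemma continuous_seminorm_of_finiteDimensional : Continuous p :=
  p.convexOn.locallyLipschitz.continuous

lemma measurableSet_seminormClosedBall [MeasurableSpace E] [OpensMeasurableSpace E] (r : ℝ) :
    MeasurableSet (p.closedBall 0 r) := by
  rw [Seminorm.closedBall_zero_eq]
  exact (isClosed_le (continuous_seminorm_of_finiteDimensional p) continuous_const).measurableSet

end FiniteDimensional

section Sudakov

variable {E : Type*} [NormedAddCommGroup E] [InnerProductSpace ℝ E] [FiniteDimensional ℝ E]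
  [MeasurableSpace E] [BorelSpace E] (p : Seminorm ℝ E)

lemma integrable_seminorm_stdGaussian : Integrable p (stdGaussian E) := by
  have hp := continuous_seminorm_of_finiteDimensional p
  obtain ⟨c, -, hc⟩ := Seminorm.bound_of_continuous_normedSpace p hp
  exact integrable_stdGaussian_of_abs_le_mul_norm hp fun x => by
    rw [abs_of_nonneg (apply_nonneg p x)]
    exact hc x

lemma three_quarters_le_stdGaussian_seminormClosedBall {a : ℝ} (ha : 0 < a)
    (hpa : ∫ x, p x ∂stdGaussian E ≤ a) :
    ENNReal.ofReal (3 / 4) ≤ stdGaussian E (p.closedBall 0 (4 * a)) := by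
  have hmarkov : 4 * a * (stdGaussian E).real {x | 4 * a ≤ p x} ≤ a :=
    (mul_meas_ge_le_integral_of_nonneg (.of_forall (apply_nonneg p))
      (integrable_seminorm_stdGaussian p) (4 * a)).trans hpa
  have htail : (stdGaussian E).real {x | 4 * a ≤ p x} ≤ 1 / 4 :=
    le_of_mul_le_mul_left (hmarkov.trans_eq (by ring)) (by positivity : 0 < 4 * a)
  have hcompl : (stdGaussian E).real (p.closedBall 0 (4 * a))ᶜ ≤ 1 / 4 := by
    refine (measureReal_mono fun x hx => ?_).trans htail
    rw [Set.mem_compl_iff, Seminorm.mem_closedBall_zero, not_le] at hx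
    exact hx.le
  rw [probReal_compl_eq_one_sub (measurableSet_seminormClosedBall p _)] at hcompl
  rw [← ofReal_measureReal]
  exact ENNReal.ofReal_le_ofReal (by linarith)

lemma three_quarters_mul_card_le_exp_of_seminorm_separated {a R s : ℝ} (ha : 0 < a) (hs : 0 < s)
    (hpa : ∫ x, p x ∂stdGaussian E ≤ a) {Z : Finset E} {y : E}
    (hZ : (Z : Set E) ⊆ Metric.closedBall y R)
    (hsep : (Z : Set E).Pairwise fun z w => s < p (z - w)) :
    3 / 4 * (Z.card : ℝ) ≤ Real.exp (32 * (a * R / s) ^ 2) := by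
  let v (z : E) : E := (2 * (4 * a) / s) • (z - y)
  have hdisj : (Z : Set E).PairwiseDisjoint fun z => v z +ᵥ p.closedBall 0 (4 * a) :=
    fun z hz w hw hzw => disjoint_vadd_seminormClosedBall p (by positivity) hs (hsep hz hw hzw) y
  have hnorm (z : E) (hz : z ∈ Z) : ‖v z‖ ≤ 8 * (a * R / s) := by
    have hzy : ‖z - y‖ ≤ R := mem_closedBall_iff_norm.1 (hZ hz)
    calc ‖v z‖ = 8 * (a / s) * ‖z - y‖ := by
          rw [norm_smul, Real.norm_of_nonneg (by positivity)]
          ring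
      _ ≤ 8 * (a / s) * R := by gcongr
      _ = 8 * (a * R / s) := by ring
  have hcard := card_mul_stdGaussian_le_exp (measurableSet_seminormClosedBall p (4 * a))
    (by simp [Seminorm.neg_closedBall]) hnorm hdisj
  rw [show (8 * (a * R / s)) ^ 2 / 2 = 32 * (a * R / s) ^ 2 by ring] at hcard
  refine (ENNReal.ofReal_le_ofReal_iff (Real.exp_pos _).le).1 (le_trans ?_ hcard)
  rw [mul_comm, ENNReal.ofReal_mul (by positivity), ENNReal.ofReal_natCast]
  gcongr
  exact three_quarters_le_stdGaussian_seminormClosedBall p ha hpa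

lemma card_le_exp_of_seminorm_separated {R s : ℝ} (hs : 0 < s) {Z : Finset E} {y : E}
    (hZ : (Z : Set E) ⊆ Metric.closedBall y R)
    (hsep : (Z : Set E).Pairwise fun z w => s < p (z - w)) :
    (Z.card : ℝ) ≤ Real.exp (64 * ((∫ x, p x ∂stdGaussian E) * R / s) ^ 2) := by
  suffices H : ∀ a > ∫ x, p x ∂stdGaussian E, (Z.card : ℝ) ≤ Real.exp (64 * (a * R / s) ^ 2) by
    have hcont : Continuous fun a : ℝ => Real.exp (64 * (a * R / s) ^ 2) := by fun_prop
    exact ge_of_tendsto (hcont.continuousWithinAt (s := Set.Ioi _))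
      (eventually_mem_nhdsWithin.mono H)
  intro a ha
  have h := three_quarters_mul_card_le_exp_of_seminorm_separated p
    ((integral_nonneg (apply_nonneg p)).trans_lt ha) hs ha.le hZ hsep
  rcases Nat.lt_or_ge Z.card 2 with hcard | hcard
  · exact le_trans (by exact_mod_cast Nat.le_of_lt_succ hcard) (Real.one_le_exp (by positivity))
  · have : (2 : ℝ) ≤ Z.card := by exact_mod_cast hcard
    calc (Z.card : ℝ) ≤ (3 / 4 * Z.card) ^ 2 := by nlinarith
      _ ≤ Real.exp (32 * (a * R / s) ^ 2) ^ 2 := by gcongr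
      _ = Real.exp (64 * (a * R / s) ^ 2) := by
        rw [← Real.exp_nat_mul]
        ring_nf

variable {K : Set E}

lemma metricPackingNumber_inter_le_exp (hp : ∀ x ∈ K, ∀ y ∈ K, ∀ u, inner ℝ (x - y) u ≤ p u)
    {δ : ℝ≥0} (hδ : 0 < δ) (y : E) :
    (Metric.packingNumber δ (K ∩ Metric.closedBall y (2 * δ)) : ℝ≥0∞) ≤
      ENNReal.ofReal (Real.exp (256 * (∫ u, p u ∂stdGaussian E) ^ 2 / δ ^ 2)) := by
  refine metricPackingNumber_le_of_forall_finset fun C hCK hC => ?_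
  have hsep : (C : Set E).Pairwise fun x z => (δ : ℝ) ^ 2 < p (x - z) := fun x hx z hz hxz => by
    have hdist : (δ : ℝ) < ‖x - z‖ :=
      (isSeparated_coe_iff.1 hC hx hz hxz).trans_eq (dist_eq_norm x z)
    calc (δ : ℝ) ^ 2 < ‖x - z‖ ^ 2 := by gcongr
      _ = inner ℝ (x - z) (x - z) := (real_inner_self_eq_norm_sq _).symm
      _ ≤ p (x - z) := hp x (hCK hx).1 z (hCK hz).1 _
  have hcard := card_le_exp_of_seminorm_separated p (by positivity)
    (hCK.trans Set.inter_subset_right) hsep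
  rw [← ENNReal.ofReal_natCast]
  refine ENNReal.ofReal_le_ofReal (hcard.trans_eq ?_)
  congr 1
  field_simp
  ring

lemma metricPackingNumber_le_exp_of_inner_sub_le (hK : Bornology.IsBounded K)
    (hp : ∀ x ∈ K, ∀ y ∈ K, ∀ u, inner ℝ (x - y) u ≤ p u) {δ : ℝ≥0} (hδ : 0 < δ) :
    (Metric.packingNumber δ K : ℝ≥0∞) ≤
      ENNReal.ofReal (Real.exp (4 / 3 * (256 * (∫ u, p u ∂stdGaussian E) ^ 2 / δ ^ 2))) := by
  refine le_exp_of_le_mul_exp_two_mul (f := fun δ => (Metric.packingNumber δ K : ℝ≥0∞))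
    (D := (Metric.ediam K).toNNReal) (by positivity) (fun δ hδ => ?_) (fun δ hδ => ?_) hδ
  · rw [← ENat.toENNReal_one, ENat.toENNReal_le]
    refine metricPackingNumber_le_one_of_ediam_le ?_
    rw [← ENNReal.coe_toNNReal hK.ediam_ne_top]
    exact_mod_cast hδ
  · refine metricPackingNumber_le_mul fun y _ => ?_
    rw [Metric.closedEBall_coe]
    exact metricPackingNumber_inter_le_exp p hp hδ y

end Sudakov

lemma integral_mul_norm_of_posHomogeneous {E : Type*} [NormedAddCommGroup E] [NormedSpace ℝ E]
    [MeasurableSpace E] [BorelSpace E] [FiniteDimensional ℝ E] [Nontrivial E] (μ : Measure E)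
    [μ.IsAddHaarMeasure] {f : E → ℝ} (hf : ∀ (c : ℝ) (x : E), 0 < c → f (c • x) = c * f x)
    (g : ℝ → ℝ) :
    ∫ x, f x * g ‖x‖ ∂μ = (∫ θ : Metric.sphere (0 : E) 1, f θ ∂μ.toSphere) *
      ∫ r : Set.Ioi (0 : ℝ), r * g r ∂Measure.volumeIoiPow (finrank ℝ E - 1) := by
  let e := homeomorphUnitSphereProd E
  calc ∫ x, f x * g ‖x‖ ∂μ
      = ∫ x : ({0}ᶜ : Set E), f x * g ‖(x : E)‖ ∂μ.comap (↑) := by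
        rw [integral_subtype_comap (measurableSet_singleton _).compl fun x => f x * g ‖x‖,
          restrict_compl_singleton]
    _ = ∫ x : ({0}ᶜ : Set E), f (e x).1 * ((e x).2 * g (e x).2) ∂μ.comap (↑) := by
        refine integral_congr_ae (.of_forall fun x => ?_)
        have hx : 0 < ‖(x : E)‖ := norm_pos_iff.2 x.2
        simp only [e, homeomorphUnitSphereProd_apply_fst_coe,
          homeomorphUnitSphereProd_apply_snd_coe]
        rw [hf _ _ (inv_pos.2 hx)]
        field_simp
    _ = ∫ z, f z.1 * (z.2 * g z.2) ∂μ.toSphere.prod (.volumeIoiPow (finrank ℝ E - 1)) :=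
        μ.measurePreserving_homeomorphUnitSphereProd.integral_comp e.measurableEmbedding
          fun z : Metric.sphere (0 : E) 1 × Set.Ioi (0 : ℝ) => f z.1 * (z.2 * g z.2)
    _ = _ := integral_prod_mul (fun θ : Metric.sphere (0 : E) 1 => f θ)
        fun r : Set.Ioi (0 : ℝ) => (r : ℝ) * g r

section GaussianPolar

variable {E : Type*} [NormedAddCommGroup E] [InnerProductSpace ℝ E] [FiniteDimensional ℝ E]
  [MeasurableSpace E] [BorelSpace E]

lemma integral_stdGaussian_eq_integral_mul_stdGaussianPDFReal (f : E → ℝ) :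
    ∫ x, f x ∂stdGaussian E = ∫ x, f x * stdGaussianPDFReal E x := by
  rw [stdGaussian_eq_withDensity, integral_withDensity_eq_integral_toReal_smul
    continuous_stdGaussianPDFReal.measurable.ennreal_ofReal (by simp)]
  refine integral_congr_ae (.of_forall fun x => ?_)
  simp only [ENNReal.toReal_ofReal (stdGaussianPDFReal_pos x).le, smul_eq_mul, mul_comm]

lemma integral_stdGaussian_of_posHomogeneous {f : E → ℝ}
    (hf : ∀ (c : ℝ) (x : E), 0 < c → f (c • x) = c * f x) :
    ∫ x, f x ∂stdGaussian E =
      (⨍ θ : Metric.sphere (0 : E) 1, f θ ∂volume.toSphere) * ∫ x, ‖x‖ ∂stdGaussian E := by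
  rcases subsingleton_or_nontrivial E with hE | hE
  · have hf0 : f 0 = 0 := by linarith [hf 2 0 two_pos, congrArg f (smul_zero (2 : ℝ) (A := E))]
    have hzero (x : E) : f x = 0 := by rw [Subsingleton.elim x 0, hf0]
    simp [hzero]
  let g (r : ℝ) : ℝ := ((2 * Real.pi) ^ (finrank ℝ E / 2 : ℝ))⁻¹ * Real.exp (-r ^ 2 / 2)
  have hfint := integral_mul_norm_of_posHomogeneous volume hf g
  have hnorm := integral_mul_norm_of_posHomogeneous (volume : Measure E) (f := norm)
    (fun c x hc => by rw [norm_smul, Real.norm_of_nonneg hc.le]) g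
  have hS : (volume : Measure E).toSphere.real Set.univ ≠ 0 :=
    have : NeZero (volume : Measure E).toSphere := ⟨Measure.toSphere_ne_zero _⟩
    measureReal_univ_ne_zero
  simp only [norm_eq_of_mem_sphere, integral_const, smul_eq_mul, mul_one] at hnorm
  rw [integral_stdGaussian_eq_integral_mul_stdGaussianPDFReal,
    integral_stdGaussian_eq_integral_mul_stdGaussianPDFReal, average_eq, smul_eq_mul]
  refine hfint.trans (Eq.trans ?_ (congrArg _ hnorm.symm))
  field_simp

end GaussianPolar

section SupportFunction

variable {n : ℕ} {K : Set (EuclideanSpace ℝ (Fin n))}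

lemma supportFunction_empty : supportFunction (∅ : Set (EuclideanSpace ℝ (Fin n))) = 0 := by
  funext θ
  simp [supportFunction]

lemma inner_le_supportFunction (hK : Bornology.IsBounded K) {x : EuclideanSpace ℝ (Fin n)}
    (hx : x ∈ K) (θ : EuclideanSpace ℝ (Fin n)) : inner ℝ x θ ≤ supportFunction K θ := by
  refine le_csSup ?_ (Set.mem_image_of_mem _ hx)
  obtain ⟨c, hc⟩ := hK.exists_norm_le
  refine ⟨c * ‖θ‖, ?_⟩
  rintro _ ⟨y, hy, rfl⟩
  exact (real_inner_le_norm y θ).trans (by gcongr; exact hc y hy)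

lemma supportFunction_le (hne : K.Nonempty) {θ : EuclideanSpace ℝ (Fin n)} {a : ℝ}
    (h : ∀ x ∈ K, inner ℝ x θ ≤ a) : supportFunction K θ ≤ a :=
  csSup_le (hne.image _) (Set.forall_mem_image.2 h)

lemma supportFunction_smul {c : ℝ} (hc : 0 ≤ c) (θ : EuclideanSpace ℝ (Fin n)) :
    supportFunction K (c • θ) = c * supportFunction K θ := by
  rw [supportFunction, supportFunction, ← smul_eq_mul, ← Real.sSup_smul_of_nonneg hc,
    ← Set.image_smul, Set.image_image]
  simp only [inner_smul_right, smul_eq_mul]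

lemma supportFunction_add_le (hK : Bornology.IsBounded K) (θ η : EuclideanSpace ℝ (Fin n)) :
    supportFunction K (θ + η) ≤ supportFunction K θ + supportFunction K η := by
  rcases K.eq_empty_or_nonempty with rfl | hne
  · simp [supportFunction_empty]
  · refine supportFunction_le hne fun x hx => ?_
    rw [inner_add_right]
    exact add_le_add (inner_le_supportFunction hK hx θ) (inner_le_supportFunction hK hx η)

lemma continuous_supportFunction (hK : Bornology.IsBounded K) :
    Continuous (supportFunction K) := by
  have hconv : ConvexOn ℝ Set.univ (supportFunction K) :=
    ⟨convex_univ, fun θ _ η _ a b ha hb _ => by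
      simpa only [supportFunction_smul ha, supportFunction_smul hb, smul_eq_mul] using
        supportFunction_add_le hK (a • θ) (b • η)⟩
  exact hconv.locallyLipschitz.continuous

lemma exists_abs_supportFunction_le_mul_norm (hK : Bornology.IsBounded K) :
    ∃ c : ℝ, ∀ θ, |supportFunction K θ| ≤ c * ‖θ‖ := by
  rcases K.eq_empty_or_nonempty with rfl | hne
  · exact ⟨0, fun θ => by simp [supportFunction_empty]⟩
  obtain ⟨c, hc⟩ := hK.exists_norm_le
  have hinner (x) (hx : x ∈ K) (θ : EuclideanSpace ℝ (Fin n)) : |inner ℝ x θ| ≤ c * ‖θ‖ :=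
    (abs_real_inner_le_norm x θ).trans (by gcongr; exact hc x hx)
  obtain ⟨x, hx⟩ := hne
  refine ⟨c, fun θ => abs_le.2 ⟨?_, supportFunction_le ⟨x, hx⟩ fun y hy =>
    (le_abs_self _).trans (hinner y hy θ)⟩⟩
  exact (abs_le.1 (hinner x hx θ)).1.trans (inner_le_supportFunction hK hx θ)

lemma integrable_supportFunction_stdGaussian (hK : Bornology.IsBounded K) :
    Integrable (supportFunction K) (stdGaussian (EuclideanSpace ℝ (Fin n))) :=
  let ⟨_, hc⟩ := exists_abs_supportFunction_le_mul_norm hK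
  integrable_stdGaussian_of_abs_le_mul_norm (continuous_supportFunction hK) hc

/-- The width `θ ↦ h_K(θ) + h_K(-θ)` of a bounded set `K` in the direction `θ`, as a seminorm. -/
noncomputable def widthSeminorm (hK : Bornology.IsBounded K) :
    Seminorm ℝ (EuclideanSpace ℝ (Fin n)) :=
  Seminorm.of (fun θ => supportFunction K θ + supportFunction K (-θ))
    (fun θ η => by
      rw [neg_add, add_add_add_comm]
      exact add_le_add (supportFunction_add_le hK θ η) (supportFunction_add_le hK (-θ) (-η)))
    (fun c θ => by
      rcases le_total 0 c with hc | hc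
      · rw [← smul_neg, supportFunction_smul hc, supportFunction_smul hc, Real.norm_of_nonneg hc,
          mul_add]
      · have hc' : 0 ≤ -c := neg_nonneg.2 hc
        rw [← neg_smul, ← neg_smul_neg c θ, supportFunction_smul hc', supportFunction_smul hc',
          Real.norm_of_nonpos hc, mul_add, add_comm])

lemma widthSeminorm_apply (hK : Bornology.IsBounded K) (θ : EuclideanSpace ℝ (Fin n)) :
    widthSeminorm hK θ = supportFunction K θ + supportFunction K (-θ) := rfl

lemma inner_sub_le_widthSeminorm (hK : Bornology.IsBounded K) {x y : EuclideanSpace ℝ (Fin n)}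
    (hx : x ∈ K) (hy : y ∈ K) (θ : EuclideanSpace ℝ (Fin n)) :
    inner ℝ (x - y) θ ≤ widthSeminorm hK θ := by
  have hyθ := inner_le_supportFunction hK hy (-θ)
  rw [inner_neg_right] at hyθ
  rw [widthSeminorm_apply, inner_sub_left]
  linarith [inner_le_supportFunction hK hx θ]

lemma integral_widthSeminorm_stdGaussian (hK : Bornology.IsBounded K) :
    ∫ θ, widthSeminorm hK θ ∂stdGaussian (EuclideanSpace ℝ (Fin n)) =
      2 * halfMeanWidth K * ∫ x, ‖x‖ ∂stdGaussian (EuclideanSpace ℝ (Fin n)) := by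
  have hint := integrable_supportFunction_stdGaussian hK
  have hmean : ∫ θ, supportFunction K θ ∂stdGaussian (EuclideanSpace ℝ (Fin n)) =
      halfMeanWidth K * ∫ x, ‖x‖ ∂stdGaussian (EuclideanSpace ℝ (Fin n)) :=
    integral_stdGaussian_of_posHomogeneous fun c θ hc => supportFunction_smul hc.le θ
  simp_rw [widthSeminorm_apply]
  rw [integral_add hint hint.comp_neg, integral_neg_eq_self, hmean]
  ring

lemma halfMeanWidth_nonneg (hK : Bornology.IsBounded K) : 0 ≤ halfMeanWidth K := by
  rcases n.eq_zero_or_pos with rfl | hn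
  · have hzero (θ : EuclideanSpace ℝ (Fin 0)) : supportFunction K θ = 0 := by
      simpa [Subsingleton.elim θ 0] using supportFunction_smul (K := K) le_rfl θ
    simp [halfMeanWidth, hzero]
  have : NeZero n := ⟨hn.ne'⟩
  have hwidth : 0 ≤ 2 * halfMeanWidth K * ∫ x, ‖x‖ ∂stdGaussian (EuclideanSpace ℝ (Fin n)) :=
    (integral_nonneg (apply_nonneg (widthSeminorm hK))).trans_eq
      (integral_widthSeminorm_stdGaussian hK)
  linarith [nonneg_of_mul_nonneg_left hwidth integral_norm_stdGaussian_pos]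

lemma metricPackingNumber_le_exp_halfMeanWidth (hK : Bornology.IsBounded K) {δ : ℝ≥0}
    (hδ : 0 < δ) :
    (Metric.packingNumber δ K : ℝ≥0∞) ≤
      ENNReal.ofReal (Real.exp (4096 / 3 * (n * (halfMeanWidth K / δ) ^ 2))) := by
  refine (metricPackingNumber_le_exp_of_inner_sub_le (widthSeminorm hK) hK
    (fun x hx y hy => inner_sub_le_widthSeminorm hK hx hy) hδ).trans ?_
  have hnorm : (∫ x, ‖x‖ ∂stdGaussian (EuclideanSpace ℝ (Fin n))) ^ 2 ≤ n :=
    integral_norm_stdGaussian_sq_le.trans_eq (by simp)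
  rw [integral_widthSeminorm_stdGaussian, mul_pow]
  refine ENNReal.ofReal_le_ofReal (Real.exp_le_exp.2 ?_)
  calc 4 / 3 * (256 * ((2 * halfMeanWidth K) ^ 2 *
        (∫ x, ‖x‖ ∂stdGaussian (EuclideanSpace ℝ (Fin n))) ^ 2) / δ ^ 2)
      ≤ 4 / 3 * (256 * ((2 * halfMeanWidth K) ^ 2 * n) / δ ^ 2) := by gcongr
    _ = 4096 / 3 * (n * (halfMeanWidth K / δ) ^ 2) := by ring

end SupportFunction

section HalfMeanWidth

variable {n : ℕ} {K : Set (EuclideanSpace ℝ (Fin n))} {m t : ℝ≥0}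

lemma metricPackingNumber_le_one_of_halfMeanWidth_eq_zero (hK : Bornology.IsBounded K)
    (hm : halfMeanWidth K = 0) (ε : ℝ≥0) : Metric.packingNumber ε K ≤ 1 := by
  have hsub : K.Subsingleton := subsingleton_of_forall_metricPackingNumber_le_one fun δ hδ => by
    rw [← ENat.toENNReal_le, ENat.toENNReal_one]
    exact (metricPackingNumber_le_exp_halfMeanWidth hK hδ).trans_eq (by simp [hm])
  exact metricPackingNumber_le_one_of_ediam_le
    ((Metric.ediam_subsingleton hsub).trans_le zero_le)

lemma metricPackingNumber_le_exp_div_sq (hK : Bornology.IsBounded K) (hm : halfMeanWidth K = m)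
    (hm_pos : 0 < m) (ht : 0 < t) :
    (Metric.packingNumber (2 * (128 * t * m)) K : ℝ≥0∞) ≤
      ENNReal.ofReal (Real.exp (n / t ^ 2)) := by
  refine (metricPackingNumber_le_exp_halfMeanWidth hK (by positivity)).trans
    (ENNReal.ofReal_le_ofReal (Real.exp_le_exp.2 ?_))
  rw [hm]
  push_cast
  calc 4096 / 3 * (n * ((m : ℝ) / (2 * (128 * t * m))) ^ 2)
      = 1 / 48 * (n / (t : ℝ) ^ 2) := by
        field_simp
        ring
    _ ≤ n / (t : ℝ) ^ 2 := mul_le_of_le_one_left (by positivity) (by norm_num)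

lemma metricPackingNumber_le_exp_div (hK : Bornology.IsBounded K) (hm : halfMeanWidth K = m)
    (hm_pos : 0 < m) (ht : 0 < t) (ht_one : t ≤ 1) :
    (Metric.packingNumber (2 * (128 * t * m)) K : ℝ≥0∞) ≤ ENNReal.ofReal (Real.exp (n / t)) := by
  have ht' : (0 : ℝ) < t := ht
  have hcoarse : (Metric.packingNumber (64 * m) K : ℝ≥0∞) ≤
      ENNReal.ofReal (Real.exp (n / 3)) := by
    refine (metricPackingNumber_le_exp_halfMeanWidth hK (by positivity)).trans_eq ?_
    rw [hm]
    push_cast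
    congr 2
    field_simp
    ring
  have hlocal (x : EuclideanSpace ℝ (Fin n)) :
      (Metric.packingNumber (2 * (128 * t * m)) (K ∩ Metric.closedEBall x (64 * m : ℝ≥0)) :
        ℝ≥0∞) ≤ ENNReal.ofReal (Real.exp (n / (2 * t))) := by
    rw [Metric.closedEBall_coe]
    refine (metricPackingNumber_le_exp_of_subset_closedBall (by positivity)
      Set.inter_subset_right).trans_eq ?_
    rw [finrank_euclideanSpace_fin]
    push_cast
    congr 2
    field_simp
    ring
  calc (Metric.packingNumber (2 * (128 * t * m)) K : ℝ≥0∞)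
      ≤ Metric.packingNumber (64 * m) K * ENNReal.ofReal (Real.exp (n / (2 * t))) :=
        metricPackingNumber_le_mul fun x _ => hlocal x
    _ ≤ ENNReal.ofReal (Real.exp (n / 3)) * ENNReal.ofReal (Real.exp (n / (2 * t))) := by
        gcongr
    _ = ENNReal.ofReal (Real.exp (n / 3 + n / (2 * t))) := by
        rw [← ENNReal.ofReal_mul (Real.exp_pos _).le, ← Real.exp_add]
    _ ≤ ENNReal.ofReal (Real.exp (n / t)) := by
        gcongr
        have hn : (n : ℝ) ≤ n / t := le_div_self n.cast_nonneg ht' (by exact_mod_cast ht_one)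
        have hhalf : (n : ℝ) / (2 * t) = n / t / 2 := by field_simp
        linarith

lemma metricPackingNumber_le_exp_div_max (hK : Bornology.IsBounded K) (hm : halfMeanWidth K = m)
    (ht : 0 < t) : (Metric.packingNumber (2 * (128 * t * m)) K : ℝ≥0∞) ≤
      ENNReal.ofReal (Real.exp (n / max (t : ℝ) ((t : ℝ) ^ 2))) := by
  rcases eq_zero_or_pos m with rfl | hm_pos
  · calc (Metric.packingNumber (2 * (128 * t * 0)) K : ℝ≥0∞) ≤ 1 := by
          exact_mod_cast metricPackingNumber_le_one_of_halfMeanWidth_eq_zero hK hm _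
      _ ≤ ENNReal.ofReal (Real.exp (n / max (t : ℝ) ((t : ℝ) ^ 2))) :=
          ENNReal.one_le_ofReal.2 (Real.one_le_exp (by positivity))
  rcases le_total t 1 with ht_one | ht_one
  · rw [max_eq_left (pow_le_of_le_one t.coe_nonneg (by exact_mod_cast ht_one) two_ne_zero)]
    exact metricPackingNumber_le_exp_div hK hm hm_pos ht ht_one
  · rw [max_eq_right (le_self_pow₀ (by exact_mod_cast ht_one) two_ne_zero)]
    exact metricPackingNumber_le_exp_div_sq hK hm hm_pos ht

end HalfMeanWidth

end SudakovMinoration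

open SudakovMinoration NNReal in
theorem theorem3p1_general :
    ∃ C : ℝ, 1 ≤ C ∧
      ∀ (n : ℕ) (K : Set (EuclideanSpace ℝ (Fin n))), Bornology.IsBounded K →
        ∀ t : ℝ, 0 < t →
          (packingNumber K
              ((C * t * halfMeanWidth K) •
                Metric.closedBall (0 : EuclideanSpace ℝ (Fin n)) 1) : ℝ≥0∞)
            ≤ ENNReal.ofReal (Real.exp ((n : ℝ) / max t (t ^ 2))) := by
  refine ⟨128, by norm_num, fun n K hK t ht => ?_⟩
  lift t to ℝ≥0 using ht.le
  obtain ⟨m, hm⟩ : ∃ m : ℝ≥0, halfMeanWidth K = m := ⟨⟨_, halfMeanWidth_nonneg hK⟩, rfl⟩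
  have hball : (128 * t * halfMeanWidth K) • Metric.closedBall (0 : EuclideanSpace ℝ (Fin n)) 1 =
      Metric.closedBall 0 (128 * t * m : ℝ≥0) := by
    rw [hm, smul_unitClosedBall_of_nonneg (by positivity)]
    push_cast
    rfl
  calc (packingNumber K ((128 * t * halfMeanWidth K) • Metric.closedBall 0 1) : ℝ≥0∞)
      ≤ Metric.packingNumber (2 * (128 * t * m)) K := by
        rw [hball]
        exact_mod_cast packingNumber_closedBall_le K (128 * t * m)
    _ ≤ _ := metricPackingNumber_le_exp_div_max hK hm ht

theorem theorem3p1 :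
    ∃ C : ℝ, 1 ≤ C ∧
      ∀ (n : ℕ) (K : Set (EuclideanSpace ℝ (Fin n))), IsCompact K →
        ∀ t : ℝ, 0 < t →
          (SudakovMinoration.packingNumber K
              ((C * t * SudakovMinoration.halfMeanWidth K) •
                Metric.closedBall (0 : EuclideanSpace ℝ (Fin n)) 1) : ℝ≥0∞)
            ≤ ENNReal.ofReal (Real.exp ((n : ℝ) / max t (t ^ 2))) :=
  let ⟨C, hC, h⟩ := theorem3p1_general
  ⟨C, hC, fun n K hK => h n K hK.isBounded⟩
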